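/- Let $\nu\in\mathbb R$ and $0<\sigma<1$, and for real $a>-1$ let $$\mathbf L_\nu(z;a)=(\tfrac12 z)^{\nu+1}\sum_{n=0}^\infty\frac{(\tfrac12 z)^{2n}}{\Gamma(n+\tfrac32)\,\Gamma(an+\nu+\tfrac32)}$$ be the generalised Struve function, with the principal branch of the power and with $1/\Gamma=0$ at the poles of $\Gamma$. For $a=-\sigma$ the series converges absolutely for all $z\in\mathbb C$, and on the positive imaginary axis $z=i|z|$ $$(\tfrac12 i|z|)^{-\nu-1}\,\mathbf L_\nu(i|z|;-\sigma)\sim\frac1\pi\sum_{k=0}^\infty\frac{\Gamma(k+\tfrac12)\,(\tfrac12|z|)^{-2k-2}}{\Gamma(\nu+\tfrac32+\sigma(k+1))}\qquad(|z|\to\infty)$$ in the sense of Poincaré: for every integer $N\ge0$, the difference between the left-hand side and the sum of the terms with $0\le k<N$ on the right is $O(|z|^{-2N-2})$ as $|z|\to\infty$, with $\nu,\sigma,N$ fixed. (In particular no other algebraic series occurs, and exponentially small contributions are not seen by the expansion.) -/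

import Mathlib

open Filter Asymptotics

/-- The `n`-th term `(z/2)^(2n) / (Γ(n + 3/2) Γ(a n + ν + 3/2))` of the series of the generalised
Struve function. Since `Complex.Gamma` is `0` at its poles and `w / 0 = 0`, the term vanishes when
`a n + ν + 3/2` is a pole, as it should because `1/Γ` vanishes there. -/
noncomputable def generalisedStruveTerm (ν a : ℝ) (z : ℂ) (n : ℕ) : ℂ :=
  (z / 2) ^ (2 * n) /
    (Complex.Gamma ((n : ℂ) + 3 / 2) * Complex.Gamma ((a : ℂ) * n + ν + 3 / 2))

/-- The generalised (modified) Struve function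
`L_ν(z; a) = (z/2)^(ν+1) ∑_{n ≥ 0} (z/2)^(2n) / (Γ(n + 3/2) Γ(a n + ν + 3/2))`,
with the principal branch of the power. -/
noncomputable def generalisedStruveL (ν : ℝ) (z : ℂ) (a : ℝ) : ℂ :=
  (z / 2) ^ ((ν : ℂ) + 1) * ∑' n : ℕ, generalisedStruveTerm ν a z n

/-- `f(r) ∼ ∑_{k ≥ 0} c k * φ k r` as `r → +∞`, in the sense of Poincaré: `φ` is an asymptotic
scale, and for every `N` the remainder after the first `N` terms is `O(φ N)`. -/
def HasPoincareExpansion (f : ℝ → ℂ) (c : ℕ → ℂ) (φ : ℕ → ℝ → ℂ) : Prop :=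
  (∀ k : ℕ, φ (k + 1) =o[atTop] φ k) ∧
    ∀ N : ℕ, (fun r : ℝ => f r - ∑ k ∈ Finset.range N, c k * φ k r) =O[atTop] φ N

/-!
With `x = (r/2)²` and `β = ν + 3/2`, the function to be expanded is the real series
`S γ β = ∑ (-x)ⁿ / (Γ(n + γ) Γ(β - σ n))` (`wrightSeries`) at `γ = 3/2`. Splitting off the first
term gives `S γ β = 1/(Γ(γ) Γ(β)) - x S (γ + 1) (β - σ)` (`wrightSeries_shift`). Read backwards and
iterated, this is the asymptotic expansion with the exact remainder
`(-1/x)ᴺ S (3/2 - N) (β + σ N)` (`wrightSeries_sub_sum`). Hence it suffices that `S γ β = O(1/x)`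
for all real `β` and all `γ` in `5/2 - ℕ`, and by one more shift it suffices that these functions
are bounded on `x ≥ 0`.

Because `n / Γ(β - σ n)` is a linear combination of `1 / Γ(β - σ n)` and `1 / Γ(β - 1 - σ n)`, the
functions with parameter `γ` are combinations of those with `γ + 1` (`wrightSeries_contiguous`), so
only `γ = 5/2` matters. There Euler's Beta integral represents `S (5/2) β` as an average of the
Wright function `W_β = S 1 β`, so finally it suffices that every `W_β` is bounded on `[0, ∞)`.

In fact `W_β` decays faster than any power. For `β = 1 - a < 1` the reflection formula and the Gamma
integral along the ray of angle `θ = π/(1 + σ)` give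
`π W_β(y) = Im (e^{iθa} ∫₀^∞ t^{a-1} exp (t e^{iθ}) exp (-y e^{iσθ} t^σ) dt)`
(`pi_mul_wrightSeries_one_eq_im`), where both exponentials decay because `σ < 1`. Replacing
`exp (t e^{iθ})` by one of its Taylor monomials gives an integral whose contribution is real, so any
Taylor polynomial may be subtracted, and the remainder yields the decay. The bounds are uniform as
`a → 0`, which covers `β = 1`, and the recurrence `(β - 1) W_β = W_{β-1} - σ y W_{β-σ}` carries the
decay to all `β > 1`.
-/

/-! ### The reciprocal Gamma function -/

theorem inv_Gamma_eq_self_mul_inv_Gamma_add_one (s : ℝ) :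
    (Real.Gamma s)⁻¹ = s * (Real.Gamma (s + 1))⁻¹ := by
  rcases eq_or_ne s 0 with rfl | hs
  · simp
  · rw [Real.Gamma_add_one hs, mul_inv, mul_inv_cancel_left₀ hs]

theorem inv_Gamma_one_sub {a : ℝ} (ha : 0 < a) :
    (Real.Gamma (1 - a))⁻¹ = Real.Gamma a * Real.sin (Real.pi * a) / Real.pi := by
  have h := Real.Gamma_mul_Gamma_one_sub a
  have hG := (Real.Gamma_pos_of_pos ha).ne'
  have hp := Real.pi_ne_zero
  rcases eq_or_ne (Real.sin (Real.pi * a)) 0 with h0 | h0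
  · rw [h0, div_zero] at h
    have : Real.Gamma (1 - a) = 0 := by simpa [hG] using h
    simp [h0, this]
  · have h1 : Real.Gamma (1 - a) = Real.pi / Real.sin (Real.pi * a) / Real.Gamma a := by
      rw [← h]; field_simp
    rw [h1]; field_simp

/-- The factor `sin (π a)` of the reflection formula removes the pole of `Γ a` at `a = 0`, which
makes the bound uniform as `a → 0`. -/
theorem abs_inv_Gamma_one_sub_le {a : ℝ} (ha : 0 < a) :
    |(Real.Gamma (1 - a))⁻¹| ≤ Real.Gamma (a + 1) := by
  have hG := Real.Gamma_pos_of_pos ha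
  rw [inv_Gamma_one_sub ha, abs_div, abs_mul, abs_of_pos hG, abs_of_pos Real.pi_pos,
    div_le_iff₀ Real.pi_pos, Real.Gamma_add_one ha.ne']
  have h : |Real.sin (Real.pi * a)| ≤ Real.pi * a := by
    have := Real.abs_sin_le_abs (x := Real.pi * a)
    rwa [abs_of_pos (mul_pos Real.pi_pos ha)] at this
  calc _ ≤ Real.Gamma a * (Real.pi * a) := mul_le_mul_of_nonneg_left h hG.le
    _ = _ := by ring

theorem Gamma_add_le_rpow_mul {a σ : ℝ} (ha : 0 < a) (hσ0 : 0 < σ) (hσ1 : σ < 1) :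
    Real.Gamma (a + σ) ≤ a ^ σ * Real.Gamma a := by
  have hG := Real.Gamma_pos_of_pos ha
  have h := Real.Gamma_mul_add_mul_le_rpow_Gamma_mul_rpow_Gamma ha (by linarith : 0 < a + 1)
    (by linarith : 0 < 1 - σ) hσ0 (by ring)
  rw [Real.Gamma_add_one ha.ne', Real.mul_rpow ha.le hG.le,
    show (1 - σ) * a + σ * (a + 1) = a + σ by ring] at h
  calc Real.Gamma (a + σ) ≤ _ := h
    _ = a ^ σ * (Real.Gamma a ^ (1 - σ) * Real.Gamma a ^ σ) := by ring
    _ = a ^ σ * Real.Gamma a := by rw [← Real.rpow_add hG]; simp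

theorem summable_pow_div_factorial_mul_Gamma {a σ : ℝ} (ha : 0 < a) (hσ0 : 0 < σ) (hσ1 : σ < 1)
    (y : ℝ) : Summable fun n : ℕ => |y| ^ n / n.factorial * Real.Gamma (a + σ * n) := by
  rcases eq_or_ne y 0 with rfl | hy
  · refine summable_of_ne_finset_zero (s := {0}) fun n hn => ?_
    simp at hn; simp [hn]
  have hy' := abs_pos.2 hy
  have hpos : ∀ n : ℕ, 0 < a + σ * n := fun n => by positivity
  have hT : ∀ n : ℕ, 0 < |y| ^ n / n.factorial * Real.Gamma (a + σ * n) := fun n => by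
    have := Real.Gamma_pos_of_pos (hpos n)
    positivity
  -- Log-convexity bounds the ratio by `|y| (a + σ n) ^ σ / (n + 1)`, which tends to zero.
  have hlim : Tendsto (fun n : ℕ => |y| * ((a + 1) ^ σ * ((n + 1 : ℝ)) ^ (-(1 - σ)))) atTop
      (nhds 0) := by
    have h1 : Tendsto (fun n : ℕ => (n + 1 : ℝ)) atTop atTop :=
      tendsto_atTop_add_const_right _ _ tendsto_natCast_atTop_atTop
    have := ((tendsto_rpow_neg_atTop (by linarith : 0 < 1 - σ)).comp h1).const_mul ((a + 1) ^ σ)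
    simpa using this.const_mul |y|
  have hev : ∀ᶠ n : ℕ in atTop, |y| * ((a + 1) ^ σ * ((n + 1 : ℝ)) ^ (-(1 - σ))) ≤ 1 / 2 :=
    hlim.eventually_le_const (by norm_num)
  refine summable_of_ratio_norm_eventually_le (r := 1 / 2) (by norm_num) ?_
  filter_upwards [hev] with n hn
  rw [Real.norm_of_nonneg (hT _).le, Real.norm_of_nonneg (hT _).le]
  have h1 : Real.Gamma (a + σ * (n + 1 : ℕ)) ≤ (a + σ * n) ^ σ * Real.Gamma (a + σ * n) := by
    have := Gamma_add_le_rpow_mul (hpos n) hσ0 hσ1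
    convert this using 2
    push_cast; ring
  have h2 : (a + σ * n) ^ σ ≤ (a + 1) ^ σ * (n + 1 : ℝ) ^ σ := by
    rw [← Real.mul_rpow (by positivity) (by positivity)]
    refine Real.rpow_le_rpow (hpos n).le ?_ hσ0.le
    have : (0 : ℝ) ≤ n := n.cast_nonneg
    nlinarith
  have h3 : (n + 1 : ℝ) ^ (-(1 - σ)) = (n + 1 : ℝ) ^ σ / (n + 1) := by
    rw [show -(1 - σ) = σ - 1 by ring, Real.rpow_sub_one (by positivity)]
  rw [h3] at hn
  have hG := Real.Gamma_pos_of_pos (hpos n)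
  calc |y| ^ (n + 1) / ((n + 1).factorial : ℝ) * Real.Gamma (a + σ * (n + 1 : ℕ))
      ≤ |y| ^ (n + 1) / ((n + 1).factorial : ℝ) *
        (((a + 1) ^ σ * (n + 1 : ℝ) ^ σ) * Real.Gamma (a + σ * n)) := by
        gcongr
        exact h1.trans (by gcongr)
    _ = (|y| * ((a + 1) ^ σ * ((n + 1 : ℝ) ^ σ / (n + 1)))) *
        (|y| ^ n / n.factorial * Real.Gamma (a + σ * n)) := by
        rw [Nat.factorial_succ]; push_cast; field_simp; ring
    _ ≤ 1 / 2 * (|y| ^ n / n.factorial * Real.Gamma (a + σ * n)) :=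
        mul_le_mul_of_nonneg_right hn (hT n).le

/-! ### The series and its recurrences -/

/-- The `n`-th term `(-x)^n / (Γ(n + γ) Γ(β - σ n))`; a factor `1/Γ` at a pole is `0`, because
`Real.Gamma` is set to `0` at its poles. -/
noncomputable def wrightTerm (σ γ β x : ℝ) (n : ℕ) : ℝ :=
  (-x) ^ n * (Real.Gamma (n + γ))⁻¹ * (Real.Gamma (β - σ * n))⁻¹

/-- The Fox–Wright type series `∑ (-x)^n / (Γ(n + γ) Γ(β - σ n))`. For `γ = 1` this is the Wright
function `φ(-σ, β; -x)`; for `γ = 3/2` it is the series of the generalised Struve function. -/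
noncomputable def wrightSeries (σ γ β x : ℝ) : ℝ := ∑' n, wrightTerm σ γ β x n

/-- `n / Γ(β - σ n)` is a combination of `1 / Γ(β - σ n)` and `1 / Γ(β - 1 - σ n)`, so lowering `γ`
does not leave the family. -/
theorem wrightTerm_contiguous {σ : ℝ} (hσ0 : 0 < σ) (γ β x : ℝ) (n : ℕ) :
    wrightTerm σ γ β x n = γ * wrightTerm σ (γ + 1) β x n +
      ((β - 1) * wrightTerm σ (γ + 1) β x n - wrightTerm σ (γ + 1) (β - 1) x n) / σ := by
  have h1 := inv_Gamma_eq_self_mul_inv_Gamma_add_one (n + γ)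
  have h2 := inv_Gamma_eq_self_mul_inv_Gamma_add_one (β - 1 - σ * n)
  rw [show β - 1 - σ * n + 1 = β - σ * n by ring] at h2
  rw [wrightTerm, wrightTerm, wrightTerm, h1, h2, ← add_assoc]
  field_simp
  ring

theorem wrightTerm_succ (σ γ β x : ℝ) (n : ℕ) :
    wrightTerm σ γ β x (n + 1) = -x * wrightTerm σ (γ + 1) (β - σ) x n := by
  rw [wrightTerm, wrightTerm, pow_succ,
    show ((n + 1 : ℕ) : ℝ) + γ = n + (γ + 1) by push_cast; ring,
    show β - σ * ((n + 1 : ℕ) : ℝ) = β - σ - σ * n by push_cast; ring]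
  ring

theorem abs_wrightTerm_one_le {a σ : ℝ} (ha : 0 < a) (hσ0 : 0 < σ) (x : ℝ) (n : ℕ) :
    |wrightTerm σ 1 (1 - a) x n| ≤ |x| ^ n / n.factorial * Real.Gamma (a + 1 + σ * n) := by
  rw [wrightTerm, abs_mul, abs_mul, abs_pow, abs_neg, Real.Gamma_nat_eq_factorial,
    abs_inv, Nat.abs_cast, ← div_eq_mul_inv, show 1 - a - σ * n = 1 - (a + σ * n) by ring,
    show a + 1 + σ * n = a + σ * n + 1 by ring]
  exact mul_le_mul_of_nonneg_left (abs_inv_Gamma_one_sub_le (by positivity)) (by positivity)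

theorem summable_wrightTerm_of_add_one {σ : ℝ} (hσ0 : 0 < σ) {γ : ℝ}
    (h : ∀ β x, Summable (wrightTerm σ (γ + 1) β x)) (β x : ℝ) :
    Summable (wrightTerm σ γ β x) := by
  rw [funext (wrightTerm_contiguous hσ0 γ β x)]
  exact ((h β x).mul_left _).add ((((h β x).mul_left _).sub (h (β - 1) x)).div_const _)

theorem abs_wrightTerm_le_of_two_le {σ γ : ℝ} (hγ : 2 ≤ γ) (β x : ℝ) (n : ℕ) :
    |wrightTerm σ γ β x n| ≤ |wrightTerm σ 1 β x n| := by
  have h0 : (0 : ℝ) ≤ n := n.cast_nonneg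
  rw [wrightTerm, wrightTerm, abs_mul, abs_mul, abs_mul, abs_mul]
  refine mul_le_mul_of_nonneg_right (mul_le_mul_of_nonneg_left ?_ (abs_nonneg _)) (abs_nonneg _)
  have h1 : Real.Gamma (n + 1) ≤ Real.Gamma (n + γ) := by
    have h2 : Real.Gamma (n + 2) ≤ Real.Gamma (n + γ) :=
      Real.Gamma_strictMonoOn_Ici.monotoneOn (by simp) (by simp; linarith) (by linarith)
    refine le_trans ?_ h2
    rw [show (n : ℝ) + 2 = n + 1 + 1 by ring, Real.Gamma_add_one (s := (n : ℝ) + 1) (by positivity)]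
    have := Real.Gamma_pos_of_pos (by positivity : (0 : ℝ) < n + 1)
    nlinarith
  have h3 := Real.Gamma_pos_of_pos (by positivity : (0 : ℝ) < n + 1)
  rw [abs_inv, abs_inv, abs_of_pos h3, abs_of_pos (h3.trans_le h1)]
  exact inv_anti₀ h3 h1

theorem summable_wrightTerm_one {σ : ℝ} (hσ0 : 0 < σ) (hσ1 : σ < 1) (β x : ℝ) :
    Summable (wrightTerm σ 1 β x) := by
  have key : ∀ a > 0, Summable (wrightTerm σ 1 (1 - a) x) := fun a ha =>
    Summable.of_abs ((summable_pow_div_factorial_mul_Gamma (a := a + 1) (by linarith) hσ0 hσ1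
      x).of_nonneg_of_le (fun _ => abs_nonneg _) (abs_wrightTerm_one_le ha hσ0 x))
  -- Dropping the first `M` terms lowers `β` by `σ M`.
  have step : ∀ M : ℕ, ∀ β, β < 1 + σ * M → Summable (wrightTerm σ 1 β x) := by
    intro M
    induction M with
    | zero => intro β hβ; simpa using key (1 - β) (by simpa using hβ)
    | succ M ih =>
      intro β hβ
      have h := (ih (β - σ) (by push_cast at hβ; linarith)).abs
      rw [← summable_nat_add_iff 1]
      simp_rw [wrightTerm_succ]
      refine Summable.mul_left _ (Summable.of_abs (h.of_nonneg_of_le (fun _ => abs_nonneg _) ?_))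
      exact abs_wrightTerm_le_of_two_le (by norm_num) _ _
  obtain ⟨M, hM⟩ := exists_nat_gt ((β - 1) / σ)
  refine step M β ?_
  rw [div_lt_iff₀ hσ0] at hM
  linarith

theorem summable_wrightTerm_half {σ : ℝ} (hσ0 : 0 < σ) (hσ1 : σ < 1) (m : ℕ) (β x : ℝ) :
    Summable (wrightTerm σ (5 / 2 - m) β x) := by
  induction m generalizing β x with
  | zero =>
    exact Summable.of_abs ((summable_wrightTerm_one hσ0 hσ1 β x).abs.of_nonneg_of_le
      (fun _ => abs_nonneg _) (abs_wrightTerm_le_of_two_le (by norm_num) _ _))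
  | succ m ih =>
    refine summable_wrightTerm_of_add_one hσ0 (fun β x => ?_) β x
    convert ih β x using 2
    push_cast; ring

theorem wrightSeries_contiguous {σ γ : ℝ} (hσ0 : 0 < σ)
    (h : ∀ β x, Summable (wrightTerm σ (γ + 1) β x)) (β x : ℝ) :
    wrightSeries σ γ β x = γ * wrightSeries σ (γ + 1) β x +
      ((β - 1) * wrightSeries σ (γ + 1) β x - wrightSeries σ (γ + 1) (β - 1) x) / σ := by
  have := ((h β x).hasSum.mul_left γ).add
    ((((h β x).hasSum.mul_left (β - 1)).sub (h (β - 1) x).hasSum).div_const σ)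
  rw [wrightSeries, funext (wrightTerm_contiguous hσ0 γ β x)]
  exact this.tsum_eq

theorem wrightSeries_shift {σ γ β x : ℝ} (h : Summable (wrightTerm σ γ β x)) :
    wrightSeries σ γ β x =
      (Real.Gamma γ)⁻¹ * (Real.Gamma β)⁻¹ - x * wrightSeries σ (γ + 1) (β - σ) x := by
  rw [wrightSeries, h.tsum_eq_zero_add]
  simp_rw [wrightTerm_succ]
  rw [tsum_mul_left, wrightSeries]
  simp [wrightTerm]
  ring

/-- The case `γ = 0` of the shift and of the contiguous relation, combined. -/
theorem wrightSeries_one_recurrence {σ : ℝ} (hσ0 : 0 < σ) (hσ1 : σ < 1) (β x : ℝ) :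
    (β - 1) * wrightSeries σ 1 β x =
      wrightSeries σ 1 (β - 1) x - σ * (x * wrightSeries σ 1 (β - σ) x) := by
  have h : ∀ β x, Summable (wrightTerm σ (0 + 1) β x) := by
    simpa using summable_wrightTerm_one hσ0 hσ1
  have h1 := wrightSeries_contiguous hσ0 h β x
  rw [wrightSeries_shift (summable_wrightTerm_of_add_one hσ0 h β x)] at h1
  simp only [Real.Gamma_zero, inv_zero, zero_mul, zero_add, zero_sub] at h1
  field_simp at h1
  linarith

/-! ### The Gamma integral along a ray -/

theorem integrableOn_rpow_mul_cexp_neg_mul {a : ℝ} (ha : 0 < a) {r : ℂ} (hr : 0 < r.re) :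
    MeasureTheory.IntegrableOn (fun t : ℝ => ((t ^ (a - 1) : ℝ) : ℂ) * Complex.exp (-(r * t)))
      (Set.Ioi 0) := by
  refine MeasureTheory.Integrable.mono' (g := fun t : ℝ => t ^ (a - 1) * Real.exp (-r.re * t)) ?_ ?_
    ?_
  · have := integrableOn_rpow_mul_exp_neg_mul_rpow (s := a - 1) (p := 1) (by linarith) one_pos hr
    simpa [MeasureTheory.IntegrableOn] using this
  · exact (by fun_prop : Measurable _).aestronglyMeasurable
  · filter_upwards [MeasureTheory.ae_restrict_mem measurableSet_Ioi] with t ht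
    rw [norm_mul, Complex.norm_real, Complex.norm_exp,
      Real.norm_of_nonneg (Real.rpow_nonneg ht.le _)]
    simp

theorem differentiableAt_integral_rpow_mul_cexp_neg_mul {a : ℝ} (ha : 0 < a) {r : ℂ}
    (hr : 0 < r.re) :
    DifferentiableAt ℂ (fun r : ℂ => ∫ t : ℝ in Set.Ioi 0,
      ((t ^ (a - 1) : ℝ) : ℂ) * Complex.exp (-(r * t))) r := by
  have hs : {z : ℂ | r.re / 2 < z.re} ∈ nhds r :=
    (isOpen_lt continuous_const Complex.continuous_re).mem_nhds (by simp; linarith)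
  refine (hasDerivAt_integral_of_dominated_loc_of_deriv_le (𝕜 := ℂ)
    (F' := fun (z : ℂ) (t : ℝ) => ((t ^ (a - 1) : ℝ) : ℂ) * (Complex.exp (-(z * t)) * (-t)))
    (bound := fun t : ℝ => t ^ a * Real.exp (-(r.re / 2) * t)) hs ?_ ?_ ?_ ?_ ?_
    ?_).2.differentiableAt
  · exact Eventually.of_forall fun z => (by fun_prop : Measurable _).aestronglyMeasurable
  · exact integrableOn_rpow_mul_cexp_neg_mul ha hr
  · exact (by fun_prop : Measurable _).aestronglyMeasurable
  · filter_upwards [MeasureTheory.ae_restrict_mem measurableSet_Ioi] with t ht z hz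
    have ht' : 0 < t := ht
    have hz' : r.re / 2 < z.re := hz
    rw [norm_mul, norm_mul, Complex.norm_real, Complex.norm_exp, norm_neg, Complex.norm_real,
      Real.norm_of_nonneg (Real.rpow_nonneg ht'.le _), Real.norm_of_nonneg ht'.le,
      mul_comm (Real.exp _), ← mul_assoc, ← Real.rpow_add_one ht'.ne', sub_add_cancel]
    refine mul_le_mul_of_nonneg_left (Real.exp_le_exp.2 ?_) (Real.rpow_nonneg ht'.le _)
    simp
    gcongr
  · have := integrableOn_rpow_mul_exp_neg_mul_rpow (s := a) (p := 1) (b := r.re / 2)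
      (by linarith) one_pos (by linarith)
    simpa [MeasureTheory.IntegrableOn] using this
  · filter_upwards with t z _
    have h : HasDerivAt (fun z : ℂ => -(z * t)) (-(1 * (t : ℂ))) z :=
      ((hasDerivAt_id z).mul_const (t : ℂ)).neg
    simpa using (h.cexp.const_mul (((t ^ (a - 1) : ℝ) : ℂ)))

/-- The Gamma integral along a ray in the right half-plane, by analytic continuation in `r` from
the positive axis. -/
theorem integral_rpow_mul_cexp_neg_mul {a : ℝ} (ha : 0 < a) {r : ℂ} (hr : 0 < r.re) :
    ∫ t : ℝ in Set.Ioi 0, ((t ^ (a - 1) : ℝ) : ℂ) * Complex.exp (-(r * t)) =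
      r ^ (-a : ℂ) * Real.Gamma a := by
  set U : Set ℂ := {z : ℂ | 0 < z.re}
  have hU : IsOpen U := isOpen_lt continuous_const Complex.continuous_re
  have hUc : IsPreconnected U := (convex_halfSpace_re_gt 0).isPreconnected
  have hf : AnalyticOnNhd ℂ (fun r : ℂ => ∫ t : ℝ in Set.Ioi 0,
      ((t ^ (a - 1) : ℝ) : ℂ) * Complex.exp (-(r * t))) U :=
    DifferentiableOn.analyticOnNhd (fun z hz =>
      (differentiableAt_integral_rpow_mul_cexp_neg_mul ha hz).differentiableWithinAt) hU
  have hg : AnalyticOnNhd ℂ (fun r : ℂ => r ^ (-a : ℂ) * Real.Gamma a) U :=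
    DifferentiableOn.analyticOnNhd (fun z hz =>
      ((differentiableAt_id.cpow_const (Or.inl hz)).mul_const _).differentiableWithinAt) hU
  have hreal : ∀ s : ℝ, 0 < s → ∫ t : ℝ in Set.Ioi 0,
      ((t ^ (a - 1) : ℝ) : ℂ) * Complex.exp (-((s : ℂ) * t)) =
        (s : ℂ) ^ (-a : ℂ) * Real.Gamma a := by
    intro s hs
    have h := Real.integral_rpow_mul_exp_neg_mul_Ioi ha hs
    rw [one_div, Real.inv_rpow hs.le, ← Real.rpow_neg hs.le] at h
    rw [← Complex.ofReal_neg, ← Complex.ofReal_cpow hs.le, ← Complex.ofReal_mul, ← h,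
      ← integral_complex_ofReal]
    push_cast
    rfl
  have hlim : Tendsto (fun n : ℕ => ((1 + 1 / ((n : ℝ) + 1) : ℝ) : ℂ)) atTop
      (nhdsWithin 1 {1}ᶜ) := by
    refine tendsto_nhdsWithin_iff.2 ⟨?_, Eventually.of_forall fun n => ?_⟩
    · have := (tendsto_one_div_add_atTop_nhds_zero_nat (𝕜 := ℝ)).const_add 1
      rw [add_zero] at this
      exact (Complex.continuous_ofReal.tendsto' 1 1 (by simp)).comp this
    · have : (n : ℝ) + 1 ≠ 0 := by positivity
      rw [Set.mem_compl_singleton_iff, Ne, Complex.ofReal_eq_one]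
      simpa using this
  exact hf.eqOn_of_preconnected_of_frequently_eq hg hUc (show (1 : ℂ) ∈ U by simp [U])
    (hlim.frequently (Frequently.of_forall fun n => hreal _ (by positivity))) hr

/-- The angle `θ = π/(1+σ)` of the ray. It exceeds `π/2`, so that `exp (t e^{iθ})` decays, and
`σ θ = π - θ` is less than `π/2`, so that `exp (-y (t e^{iθ})^σ)` decays as well. -/
noncomputable def rayAngle (σ : ℝ) : ℝ := Real.pi / (1 + σ)

theorem rayAngle_add_mul {σ : ℝ} (hσ0 : 0 < σ) : rayAngle σ + σ * rayAngle σ = Real.pi := by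
  rw [rayAngle]; field_simp

theorem mul_rayAngle_pos {σ : ℝ} (hσ0 : 0 < σ) : 0 < σ * rayAngle σ := by
  rw [rayAngle]; have := Real.pi_pos; positivity

theorem mul_rayAngle_lt {σ : ℝ} (hσ0 : 0 < σ) (hσ1 : σ < 1) : σ * rayAngle σ < Real.pi / 2 := by
  rw [rayAngle, mul_div_assoc', div_lt_div_iff₀ (by positivity) two_pos]
  nlinarith [Real.pi_pos]

theorem cos_mul_rayAngle_pos {σ : ℝ} (hσ0 : 0 < σ) (hσ1 : σ < 1) :
    0 < Real.cos (σ * rayAngle σ) :=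
  Real.cos_pos_of_mem_Ioo ⟨by linarith [mul_rayAngle_pos hσ0, Real.pi_pos],
    mul_rayAngle_lt hσ0 hσ1⟩

/-- The unit number `e^{iφ}`. -/
noncomputable def unitAt (φ : ℝ) : ℂ := Complex.exp (φ * Complex.I)

theorem unitAt_add (φ ψ : ℝ) : unitAt (φ + ψ) = unitAt φ * unitAt ψ := by
  rw [unitAt, unitAt, unitAt, ← Complex.exp_add]; push_cast; ring_nf

theorem unitAt_zero : unitAt 0 = 1 := by simp [unitAt]

theorem unitAt_mul_natCast (φ : ℝ) (n : ℕ) : unitAt (φ * n) = unitAt φ ^ n := by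
  rw [unitAt, unitAt, ← Complex.exp_nat_mul]; push_cast; ring_nf

theorem norm_unitAt (φ : ℝ) : ‖unitAt φ‖ = 1 := Complex.norm_exp_ofReal_mul_I φ

theorem unitAt_re (φ : ℝ) : (unitAt φ).re = Real.cos φ := Complex.exp_ofReal_mul_I_re φ

theorem unitAt_im (φ : ℝ) : (unitAt φ).im = Real.sin φ := Complex.exp_ofReal_mul_I_im φ

theorem unitAt_pi : unitAt Real.pi = -1 := Complex.exp_pi_mul_I

theorem mul_unitAt_cpow {φ : ℝ} (h1 : -Real.pi < φ) (h2 : φ ≤ Real.pi) {y : ℝ} (hy : 0 < y)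
    (b : ℝ) : ((y : ℂ) * unitAt φ) ^ (b : ℂ) = ((y ^ b : ℝ) : ℂ) * unitAt (φ * b) := by
  have h : (y : ℂ) * unitAt φ = Complex.exp ((Real.log y : ℝ) + φ * Complex.I) := by
    rw [Complex.exp_add, ← Complex.ofReal_exp, Real.exp_log hy, unitAt]
  rw [Complex.cpow_def_of_ne_zero (by rw [h]; exact Complex.exp_ne_zero _), h, Complex.log_exp
    (by simpa using h1) (by simpa using h2), Real.rpow_def_of_pos hy, Complex.ofReal_exp, unitAt,
    ← Complex.exp_add]
  push_cast; ring_nf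

/-- Reflection turns `π / Γ(1 - a)` into the imaginary part of a Gamma integral along the ray
of angle `rayAngle σ`: Hankel's loop integral, collapsed onto two conjugate rays. -/
theorem pi_mul_inv_Gamma_eq_im {σ a : ℝ} (hσ0 : 0 < σ) (hσ1 : σ < 1) (ha : 0 < a) :
    Real.pi * (Real.Gamma (1 - a))⁻¹ = (unitAt (rayAngle σ * a) *
      ∫ t : ℝ in Set.Ioi 0, ((t ^ (a - 1) : ℝ) : ℂ) *
        Complex.exp (-(unitAt (-(σ * rayAngle σ)) * t))).im := by
  have h1 := mul_rayAngle_pos hσ0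
  have h2 := mul_rayAngle_lt hσ0 hσ1
  have hre : 0 < (unitAt (-(σ * rayAngle σ))).re := by
    rw [unitAt_re, Real.cos_neg]; exact cos_mul_rayAngle_pos hσ0 hσ1
  have h3 := mul_unitAt_cpow (φ := -(σ * rayAngle σ)) (by linarith) (by linarith) one_pos (-a)
  rw [Complex.ofReal_one, one_mul, Real.one_rpow, Complex.ofReal_one, one_mul,
    Complex.ofReal_neg] at h3
  rw [integral_rpow_mul_cexp_neg_mul ha hre, h3, ← mul_assoc, ← unitAt_add,
    show rayAngle σ * a + -(σ * rayAngle σ) * -a = (rayAngle σ + σ * rayAngle σ) * a by ring,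
    rayAngle_add_mul hσ0, Complex.im_mul_ofReal, unitAt_im, inv_Gamma_one_sub ha]
  field_simp

/-- Without the factor `exp (-r t)`, the integral along the ray is real after multiplication by the
phase: the substitution `s = t ^ σ` makes it a Gamma integral, whose phase `e^{-iθb}` cancels. -/
theorem im_integral_rpow_mul_cexp_neg_rpow {σ b y : ℝ} (hσ0 : 0 < σ) (hσ1 : σ < 1) (hb : 0 < b)
    (hy : 0 < y) :
    (unitAt (rayAngle σ * b) * ∫ t : ℝ in Set.Ioi 0, ((t ^ (b - 1) : ℝ) : ℂ) *
      Complex.exp (-(y * unitAt (σ * rayAngle σ) * (t ^ σ : ℝ)))).im = 0 := by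
  have h1 := mul_rayAngle_pos hσ0
  have h2 := mul_rayAngle_lt hσ0 hσ1
  have hre : 0 < ((y : ℂ) * unitAt (σ * rayAngle σ)).re := by
    rw [Complex.re_ofReal_mul, unitAt_re]; exact mul_pos hy (cos_mul_rayAngle_pos hσ0 hσ1)
  have h := integral_rpow_mul_cexp_neg_mul (a := b / σ) (by positivity) hre
  have h3 := mul_unitAt_cpow (φ := σ * rayAngle σ) (by linarith) (by linarith) hy (-(b / σ))
  rw [Complex.ofReal_neg] at h3
  rw [h3, ← MeasureTheory.integral_comp_rpow_Ioi_of_pos hσ0] at h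
  have h4 : ∫ t : ℝ in Set.Ioi 0, (σ * t ^ (σ - 1)) • ((((t ^ σ) ^ (b / σ - 1) : ℝ) : ℂ) *
      Complex.exp (-(y * unitAt (σ * rayAngle σ) * (t ^ σ : ℝ)))) =
      (σ : ℂ) * ∫ t : ℝ in Set.Ioi 0, ((t ^ (b - 1) : ℝ) : ℂ) *
      Complex.exp (-(y * unitAt (σ * rayAngle σ) * (t ^ σ : ℝ))) := by
    rw [← MeasureTheory.integral_const_mul]
    refine MeasureTheory.setIntegral_congr_fun measurableSet_Ioi fun t (ht : 0 < t) => ?_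
    have : t ^ (b - 1) = t ^ (σ - 1) * (t ^ σ) ^ (b / σ - 1) := by
      rw [← Real.rpow_mul ht.le, ← Real.rpow_add ht]
      congr 1; field_simp; ring
    simp only [this, Complex.real_smul]
    push_cast; ring
  rw [h4] at h
  have h5 : (∫ t : ℝ in Set.Ioi 0, ((t ^ (b - 1) : ℝ) : ℂ) *
      Complex.exp (-(y * unitAt (σ * rayAngle σ) * (t ^ σ : ℝ)))) =
      ((y ^ (-(b / σ)) * Real.Gamma (b / σ) / σ : ℝ) : ℂ) * unitAt (-(rayAngle σ * b)) := by
    have hσ : (σ : ℂ) ≠ 0 := by exact_mod_cast hσ0.ne'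
    rw [show σ * rayAngle σ * -(b / σ) = -(rayAngle σ * b) by field_simp] at h
    refine mul_left_cancel₀ hσ (h.trans ?_)
    push_cast; field_simp
  rw [h5, mul_left_comm, ← unitAt_add, add_neg_cancel, unitAt_zero, mul_one, Complex.ofReal_im]

theorem norm_exp_sub_sum_le_of_re_nonpos {z : ℂ} (hz : z.re ≤ 0) (J : ℕ) :
    ‖Complex.exp z - ∑ j ∈ Finset.range J, z ^ j / j.factorial‖ ≤ (J + 3) * ‖z‖ ^ J := by
  have hJ : (0 : ℝ) ≤ J := J.cast_nonneg
  rcases le_total ‖z‖ 1 with h | h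
  · refine (Complex.norm_exp_sub_sum_le_norm_mul_exp z J).trans ?_
    rw [mul_comm]
    refine mul_le_mul_of_nonneg_right ?_ (by positivity)
    have := (Real.exp_le_exp.2 h).trans Real.exp_one_lt_three.le
    linarith
  · have h1 : ‖∑ j ∈ Finset.range J, z ^ j / (j.factorial : ℂ)‖ ≤ J * ‖z‖ ^ J := by
      refine (norm_sum_le_of_le (f := fun j : ℕ => z ^ j / (j.factorial : ℂ)) (Finset.range J)
        (n := fun _ => ‖z‖ ^ J) fun j hj => ?_).trans (by simp)
      rw [norm_div, norm_pow, Complex.norm_natCast]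
      refine (div_le_self (by positivity) ?_).trans
        (pow_le_pow_right₀ h (Finset.mem_range.1 hj).le)
      exact_mod_cast j.factorial_pos
    have h2 : ‖Complex.exp z‖ ≤ 1 := by rw [Complex.norm_exp]; exact Real.exp_le_one_iff.2 hz
    have h3 : 1 ≤ ‖z‖ ^ J := one_le_pow₀ h
    refine (norm_sub_le _ _).trans ?_
    nlinarith

theorem integrableOn_rpow_mul_cexp_neg_rpow {σ b y : ℝ} (hσ0 : 0 < σ) (hσ1 : σ < 1) (hb : 0 < b)
    (hy : 0 < y) :
    MeasureTheory.IntegrableOn (fun t : ℝ => ((t ^ (b - 1) : ℝ) : ℂ) *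
      Complex.exp (-(y * unitAt (σ * rayAngle σ) * (t ^ σ : ℝ)))) (Set.Ioi 0) := by
  refine MeasureTheory.Integrable.mono' (integrableOn_rpow_mul_exp_neg_mul_rpow (s := b - 1)
    (p := σ) (b := y * Real.cos (σ * rayAngle σ)) (by linarith) hσ0
    (mul_pos hy (cos_mul_rayAngle_pos hσ0 hσ1))) ?_ ?_
  · exact (by fun_prop : Measurable _).aestronglyMeasurable
  · filter_upwards [MeasureTheory.ae_restrict_mem measurableSet_Ioi] with t ht
    rw [norm_mul, Complex.norm_real, Complex.norm_exp,
      Real.norm_of_nonneg (Real.rpow_nonneg ht.le _), Complex.neg_re, Complex.re_mul_ofReal,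
      Complex.re_ofReal_mul, unitAt_re, neg_mul]

/-! ### Rapid decay of the Wright function -/

/-- The integrand of the ray representation of the Wright function, without its constant phase. -/
noncomputable def rayKernel (σ a y t : ℝ) : ℂ :=
  ((t ^ (a - 1) : ℝ) : ℂ) * Complex.exp (-(unitAt (-(σ * rayAngle σ)) * t)) *
    Complex.exp (-(y * unitAt (σ * rayAngle σ) * (t ^ σ : ℝ)))

theorem pi_mul_wrightSeries_one_eq_im {σ a : ℝ} (hσ0 : 0 < σ) (hσ1 : σ < 1) (ha : 0 < a) (y : ℝ) :
    Real.pi * wrightSeries σ 1 (1 - a) y =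
      (unitAt (rayAngle σ * a) * ∫ t : ℝ in Set.Ioi 0, rayKernel σ a y t).im := by
  set r := unitAt (-(σ * rayAngle σ)) with hr
  set c := Real.cos (σ * rayAngle σ) with hc
  have hc0 : 0 < c := cos_mul_rayAngle_pos hσ0 hσ1
  have hrc : r.re = c := by rw [hr, unitAt_re, Real.cos_neg]
  have hapos : ∀ n : ℕ, 0 < a + σ * n := fun n => by positivity
  let G : ℕ → ℝ → ℂ := fun n t =>
    ((t ^ (a + σ * n - 1) : ℝ) : ℂ) * Complex.exp (-(r * t))
  let k : ℕ → ℂ := fun n => (((-y) ^ n / n.factorial : ℝ) : ℂ) * unitAt (rayAngle σ * (a + σ * n))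
  have hk : ∀ n, ‖k n‖ = |y| ^ n / n.factorial := fun n => by
    simp only [k]
    rw [norm_mul, norm_unitAt, mul_one, Complex.norm_real, norm_div, norm_pow, norm_neg,
      Real.norm_eq_abs, Real.norm_eq_abs, Nat.abs_cast]
  have hint : ∀ n, MeasureTheory.IntegrableOn (fun t => k n * G n t) (Set.Ioi 0) := fun n =>
    (integrableOn_rpow_mul_cexp_neg_mul (hapos n) (by rw [hrc]; exact hc0)).const_mul _
  have hnorm : ∀ n, ∫ t in Set.Ioi 0, ‖k n * G n t‖ =
      (1 / c) ^ a * (|y * (1 / c) ^ σ| ^ n / n.factorial * Real.Gamma (a + σ * n)) := by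
    intro n
    have h1 : ∫ t in Set.Ioi 0, ‖k n * G n t‖ =
        |y| ^ n / n.factorial * ∫ t in Set.Ioi 0, t ^ (a + σ * n - 1) * Real.exp (-(c * t)) := by
      rw [← MeasureTheory.integral_const_mul]
      refine MeasureTheory.setIntegral_congr_fun measurableSet_Ioi fun t (ht : 0 < t) => ?_
      simp only [G]
      rw [norm_mul, hk, norm_mul, Complex.norm_real, Complex.norm_exp,
        Real.norm_of_nonneg (Real.rpow_nonneg ht.le _), Complex.neg_re, Complex.re_mul_ofReal, hrc]
    rw [h1, Real.integral_rpow_mul_exp_neg_mul_Ioi (hapos n) hc0, Real.rpow_add (by positivity),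
      Real.rpow_mul (by positivity), Real.rpow_natCast, abs_mul,
      abs_of_pos (Real.rpow_pos_of_pos (by positivity : 0 < 1 / c) σ), mul_pow]
    ring
  have hsum : Summable fun n => ∫ t in Set.Ioi 0, ‖k n * G n t‖ := by
    simp_rw [hnorm]
    exact (summable_pow_div_factorial_mul_Gamma ha hσ0 hσ1 _).mul_left _
  have h := MeasureTheory.hasSum_integral_of_summable_integral_norm hint hsum
  -- The exponential series in `-y e^{iσθ} t ^ σ` reassembles the kernel.
  have hker : ∀ t ∈ Set.Ioi (0 : ℝ), ∑' n, k n * G n t =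
      unitAt (rayAngle σ * a) * rayKernel σ a y t := by
    intro t (ht : 0 < t)
    have he := (NormedSpace.expSeries_div_hasSum_exp
      (-(y * unitAt (σ * rayAngle σ) * (t ^ σ : ℝ)) : ℂ)).mul_left
      (unitAt (rayAngle σ * a) * (((t ^ (a - 1) : ℝ) : ℂ) * Complex.exp (-(r * t))))
    rw [← Complex.exp_eq_exp_ℂ] at he
    rw [rayKernel, ← mul_assoc, ← hr, ← he.tsum_eq]
    refine tsum_congr fun n => ?_
    simp only [k, G]
    rw [show a + σ * n - 1 = (a - 1) + σ * n by ring, Real.rpow_add ht, Real.rpow_mul ht.le,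
      Real.rpow_natCast, show rayAngle σ * (a + σ * n) = rayAngle σ * a + σ * rayAngle σ * n by ring,
      unitAt_add, unitAt_mul_natCast]
    push_cast
    ring
  rw [MeasureTheory.setIntegral_congr_fun measurableSet_Ioi hker,
    MeasureTheory.integral_const_mul] at h
  have him := (Complex.imCLM.hasSum h).mul_left (Real.pi)⁻¹
  have hterm : ∀ n, Real.pi⁻¹ * Complex.imCLM (∫ t in Set.Ioi 0, k n * G n t) =
      wrightTerm σ 1 (1 - a) y n := by
    intro n
    have h1 := pi_mul_inv_Gamma_eq_im hσ0 hσ1 (hapos n)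
    rw [MeasureTheory.integral_const_mul, Complex.imCLM_apply]
    simp only [k]
    rw [mul_assoc, Complex.im_ofReal_mul, ← h1, wrightTerm, Real.Gamma_nat_eq_factorial,
      show 1 - a - σ * n = 1 - (a + σ * n) by ring]
    field_simp
  simp only [hterm] at him
  rw [wrightSeries, him.tsum_eq, Complex.imCLM_apply, mul_inv_cancel_left₀ Real.pi_ne_zero]

/-- Subtracting a Taylor polynomial of `exp (-r t)` does not change the imaginary part, and the
remainder gains the factor `t ^ J`. -/
theorem pi_mul_abs_wrightSeries_one_le {σ a y : ℝ} (hσ0 : 0 < σ) (hσ1 : σ < 1) (ha : 0 < a)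
    (hy : 0 < y) (J : ℕ) :
    Real.pi * |wrightSeries σ 1 (1 - a) y| ≤ ∫ t : ℝ in Set.Ioi 0,
      (J + 3) * (t ^ (a + J - 1) * Real.exp (-(y * Real.cos (σ * rayAngle σ)) * t ^ σ)) := by
  set r := unitAt (-(σ * rayAngle σ)) with hr
  set c := Real.cos (σ * rayAngle σ) with hc
  have hc0 : 0 < c := cos_mul_rayAngle_pos hσ0 hσ1
  have hrc : r.re = c := by rw [hr, unitAt_re, Real.cos_neg]
  have hJint : ∀ j : ℕ, MeasureTheory.IntegrableOn
      (fun t : ℝ => t ^ (a + j - 1) * Real.exp (-(y * c) * t ^ σ)) (Set.Ioi 0) := fun j =>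
    integrableOn_rpow_mul_exp_neg_mul_rpow (by have : (0:ℝ) ≤ j := j.cast_nonneg; linarith) hσ0
      (mul_pos hy hc0)
  let E : ℝ → ℂ := fun t => Complex.exp (-(y * unitAt (σ * rayAngle σ) * (t ^ σ : ℝ)))
  let P : ℕ → ℝ → ℂ := fun j t => (-r) ^ j / j.factorial * (((t ^ (a + j - 1) : ℝ) : ℂ) * E t)
  let R : ℝ → ℂ := fun t => ((t ^ (a - 1) : ℝ) : ℂ) *
    (Complex.exp (-(r * t)) - ∑ j ∈ Finset.range J, (-(r * t)) ^ j / j.factorial) * E t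
  have hPint : ∀ j, MeasureTheory.IntegrableOn (P j) (Set.Ioi 0) := fun j =>
    (integrableOn_rpow_mul_cexp_neg_rpow hσ0 hσ1 (by positivity : 0 < a + j) hy).const_mul _
  have hE : ∀ t, ‖E t‖ = Real.exp (-(y * c) * t ^ σ) := fun t => by
    simp only [E]
    rw [Complex.norm_exp, Complex.neg_re, Complex.re_mul_ofReal, Complex.re_ofReal_mul, unitAt_re,
      neg_mul]
  have hRle : ∀ t ∈ Set.Ioi (0 : ℝ),
      ‖R t‖ ≤ (J + 3) * (t ^ (a + J - 1) * Real.exp (-(y * c) * t ^ σ)) := by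
    intro t (ht : 0 < t)
    have h1 := norm_exp_sub_sum_le_of_re_nonpos (z := -(r * t))
      (by rw [Complex.neg_re, Complex.re_mul_ofReal, hrc]; nlinarith) J
    rw [norm_neg, norm_mul, hr, norm_unitAt, one_mul, Complex.norm_real,
      Real.norm_of_nonneg ht.le, ← hr] at h1
    simp only [R]
    rw [norm_mul, norm_mul, hE, Complex.norm_real, Real.norm_of_nonneg (Real.rpow_nonneg ht.le _),
      show a + J - 1 = a - 1 + J by ring, Real.rpow_add ht, Real.rpow_natCast]
    calc _ ≤ t ^ (a - 1) * ((J + 3) * t ^ J) * Real.exp (-(y * c) * t ^ σ) := by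
          gcongr
      _ = _ := by ring
  have hRint : MeasureTheory.IntegrableOn R (Set.Ioi 0) := by
    refine MeasureTheory.Integrable.mono' ((hJint J).const_mul ((J : ℝ) + 3)) ?_ ?_
    · exact (by fun_prop : Measurable R).aestronglyMeasurable
    · filter_upwards [MeasureTheory.ae_restrict_mem measurableSet_Ioi] with t ht
      exact hRle t ht
  have hsplit : ∀ t ∈ Set.Ioi (0 : ℝ), rayKernel σ a y t = R t + ∑ j ∈ Finset.range J, P j t := by
    intro t (ht : 0 < t)
    have h1 : ∑ j ∈ Finset.range J, P j t = ((t ^ (a - 1) : ℝ) : ℂ) *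
        (∑ j ∈ Finset.range J, (-(r * t)) ^ j / j.factorial) * E t := by
      rw [Finset.mul_sum, Finset.sum_mul]
      refine Finset.sum_congr rfl fun j _ => ?_
      simp only [P]
      rw [show a + j - 1 = a - 1 + j by ring, Real.rpow_add ht, Real.rpow_natCast, ← neg_mul,
        mul_pow]
      push_cast
      ring
    rw [h1, rayKernel]
    simp only [R, E]
    ring
  have hP0 : ∀ j, (unitAt (rayAngle σ * a) * ∫ t in Set.Ioi 0, P j t).im = 0 := by
    intro j
    have h1 := im_integral_rpow_mul_cexp_neg_rpow hσ0 hσ1 (by positivity : 0 < a + j) hy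
    have h2 : -r = unitAt (rayAngle σ) := by
      have h3 : Real.pi + -(σ * rayAngle σ) = rayAngle σ := by linarith [rayAngle_add_mul hσ0]
      rw [← h3, unitAt_add, unitAt_pi, ← hr, neg_one_mul]
    simp only [P]
    rw [MeasureTheory.integral_const_mul, h2, ← unitAt_mul_natCast, ← mul_assoc,
      show unitAt (rayAngle σ * a) * (unitAt (rayAngle σ * j) / (j.factorial : ℂ)) =
        (((j.factorial : ℝ)⁻¹ : ℝ) : ℂ) * unitAt (rayAngle σ * (a + j)) by
        rw [mul_add, unitAt_add]; push_cast; ring, mul_assoc, Complex.im_ofReal_mul, h1, mul_zero]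
  have hmain : Real.pi * wrightSeries σ 1 (1 - a) y =
      (unitAt (rayAngle σ * a) * ∫ t in Set.Ioi 0, R t).im := by
    rw [pi_mul_wrightSeries_one_eq_im hσ0 hσ1 ha,
      MeasureTheory.setIntegral_congr_fun measurableSet_Ioi hsplit,
      MeasureTheory.integral_add hRint (MeasureTheory.integrable_finsetSum _ fun j _ => hPint j),
      MeasureTheory.integral_finsetSum _ fun j _ => hPint j, mul_add, Complex.add_im,
      Finset.mul_sum, Complex.im_sum, Finset.sum_eq_zero fun j _ => hP0 j, add_zero]
  calc Real.pi * |wrightSeries σ 1 (1 - a) y| = |Real.pi * wrightSeries σ 1 (1 - a) y| := by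
        rw [abs_mul, abs_of_pos Real.pi_pos]
    _ ≤ ‖unitAt (rayAngle σ * a) * ∫ t in Set.Ioi 0, R t‖ := by
        rw [hmain]; exact Complex.abs_im_le_norm _
    _ = ‖∫ t in Set.Ioi 0, R t‖ := by rw [norm_mul, norm_unitAt, one_mul]
    _ ≤ _ := by
        refine MeasureTheory.norm_integral_le_of_norm_le ((hJint J).const_mul ((J : ℝ) + 3)) ?_
        filter_upwards [MeasureTheory.ae_restrict_mem measurableSet_Ioi] with t ht
        exact hRle t ht

/-- Decay faster than any power, uniformly for `1 - A ≤ β < 1`. -/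
theorem exists_pow_mul_abs_wrightSeries_one_le {σ : ℝ} (hσ0 : 0 < σ) (hσ1 : σ < 1) (A : ℝ)
    (K : ℕ) : ∃ C, ∀ a, 0 < a → a ≤ A → ∀ y ≥ 1,
      y ^ K * |wrightSeries σ 1 (1 - a) y| ≤ C := by
  rcases le_or_gt A 0 with hA | hA
  · exact ⟨0, fun a h1 h2 => by linarith⟩
  set c := Real.cos (σ * rayAngle σ) with hc
  have hc0 : 0 < c := cos_mul_rayAngle_pos hσ0 hσ1
  -- One power more than `K` keeps the exponent `J - 1` of `t` integrable at `0` even for `a → 0`;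
  -- the bounds at `a = 0` and `a = A` dominate those in between.
  set J := K + 1 with hJ
  have hJ1 : (1 : ℝ) ≤ J := by rw [hJ]; push_cast; linarith [K.cast_nonneg (α := ℝ)]
  let D : ℝ → ℝ := fun q => c ^ (-(q + 1) / σ) * (1 / σ) * Real.Gamma ((q + 1) / σ)
  have hD : ∀ q : ℝ, K ≤ q → ∀ y ≥ 1, y ^ K * ∫ t : ℝ in Set.Ioi 0,
      t ^ q * Real.exp (-(y * c) * t ^ σ) ≤ D q := by
    intro q hq y hy
    have hy0 : 0 < y := by linarith
    have hK : (0 : ℝ) ≤ K := K.cast_nonneg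
    rw [integral_rpow_mul_exp_neg_mul_rpow hσ0 (by linarith) (mul_pos hy0 hc0),
      Real.mul_rpow hy0.le hc0.le]
    have h1 : y ^ K * y ^ (-(q + 1) / σ) ≤ 1 := by
      rw [← Real.rpow_natCast, ← Real.rpow_add hy0]
      refine Real.rpow_le_one_of_one_le_of_nonpos hy ?_
      have : q + 1 ≤ (q + 1) / σ := by
        rw [le_div_iff₀ hσ0]; nlinarith
      rw [neg_div]; linarith
    have h2 : 0 ≤ D q := by
      have := Real.Gamma_pos_of_pos (div_pos (by linarith : 0 < q + 1) hσ0)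
      simp only [D]; positivity
    calc _ = (y ^ K * y ^ (-(q + 1) / σ)) * D q := by simp only [D]; ring
      _ ≤ 1 * D q := mul_le_mul_of_nonneg_right h1 h2
      _ = D q := one_mul _
  refine ⟨Real.pi⁻¹ * ((J + 3) * (D (J - 1) + D (A + J - 1))), fun a ha haA y hy => ?_⟩
  have hy0 : 0 < y := by linarith
  have h1 := pi_mul_abs_wrightSeries_one_le hσ0 hσ1 ha hy0 J
  have hint : ∀ q : ℝ, -1 < q → MeasureTheory.IntegrableOn
      (fun t : ℝ => t ^ q * Real.exp (-(y * c) * t ^ σ)) (Set.Ioi 0) := fun q hq =>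
    integrableOn_rpow_mul_exp_neg_mul_rpow hq hσ0 (mul_pos hy0 hc0)
  have h2 : ∫ t : ℝ in Set.Ioi 0, t ^ (a + J - 1) * Real.exp (-(y * c) * t ^ σ) ≤
      (∫ t : ℝ in Set.Ioi 0, t ^ ((J : ℝ) - 1) * Real.exp (-(y * c) * t ^ σ)) +
      ∫ t : ℝ in Set.Ioi 0, t ^ (A + J - 1) * Real.exp (-(y * c) * t ^ σ) := by
    rw [← MeasureTheory.integral_add (hint _ (by linarith)) (hint _ (by linarith))]
    refine MeasureTheory.setIntegral_mono_on (hint _ (by linarith))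
      ((hint _ (by linarith)).add (hint _ (by linarith))) measurableSet_Ioi
      fun t (ht : 0 < t) => ?_
    rw [← add_mul]
    refine mul_le_mul_of_nonneg_right ?_ (Real.exp_nonneg _)
    rcases le_total t 1 with h | h
    · exact (Real.rpow_le_rpow_of_exponent_ge ht h (by linarith)).trans
        (le_add_of_nonneg_right (Real.rpow_nonneg ht.le _))
    · exact (Real.rpow_le_rpow_of_exponent_le h (by linarith)).trans
        (le_add_of_nonneg_left (Real.rpow_nonneg ht.le _))
  rw [MeasureTheory.integral_const_mul] at h1
  have h3 := hD (J - 1) (by rw [hJ]; push_cast; linarith) y hy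
  have h4 := hD (A + J - 1) (by rw [hJ]; push_cast; linarith) y hy
  rw [inv_mul_eq_div, le_div_iff₀ Real.pi_pos]
  calc y ^ K * |wrightSeries σ 1 (1 - a) y| * Real.pi
      = y ^ K * (Real.pi * |wrightSeries σ 1 (1 - a) y|) := by ring
    _ ≤ y ^ K * ((J + 3) * ((∫ t : ℝ in Set.Ioi 0, t ^ ((J : ℝ) - 1) *
        Real.exp (-(y * c) * t ^ σ)) +
        ∫ t : ℝ in Set.Ioi 0, t ^ (A + J - 1) * Real.exp (-(y * c) * t ^ σ))) :=
        mul_le_mul_of_nonneg_left (h1.trans (mul_le_mul_of_nonneg_left h2 (by positivity)))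
          (by positivity)
    _ = (J + 3) * (y ^ K * (∫ t : ℝ in Set.Ioi 0, t ^ ((J : ℝ) - 1) *
        Real.exp (-(y * c) * t ^ σ)) +
        y ^ K * ∫ t : ℝ in Set.Ioi 0, t ^ (A + J - 1) * Real.exp (-(y * c) * t ^ σ)) := by ring
    _ ≤ (J + 3) * (D (J - 1) + D (A + J - 1)) :=
        mul_le_mul_of_nonneg_left (add_le_add h3 h4) (by positivity)

theorem continuous_inv_Gamma : Continuous fun s : ℝ => (Real.Gamma s)⁻¹ := by
  have h : Continuous fun s : ℝ => ((Complex.Gamma s)⁻¹).re :=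
    Complex.continuous_re.comp
      (Complex.differentiable_one_div_Gamma.continuous.comp Complex.continuous_ofReal)
  refine h.congr fun s => ?_
  rw [Complex.Gamma_ofReal, ← Complex.ofReal_inv, Complex.ofReal_re]

/-- Dominated convergence, with the bound `Γ(1 + a + σ n)` for the reciprocal Gamma factor,
controlled for `0 < a < 1` by its values at the endpoints through convexity. -/
theorem tendsto_wrightSeries_one {σ : ℝ} (hσ0 : 0 < σ) (hσ1 : σ < 1) (y : ℝ) :
    Tendsto (fun a => wrightSeries σ 1 (1 - a) y) (nhdsWithin 0 (Set.Ioi 0))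
      (nhds (wrightSeries σ 1 1 y)) := by
  have hs : Summable fun n : ℕ => |y| ^ n / n.factorial * Real.Gamma (1 + σ * n) +
      |y| ^ n / n.factorial * Real.Gamma (2 + σ * n) :=
    (summable_pow_div_factorial_mul_Gamma one_pos hσ0 hσ1 y).add
      (summable_pow_div_factorial_mul_Gamma two_pos hσ0 hσ1 y)
  refine tendsto_tsum_of_dominated_convergence hs (fun n => ?_) ?_
  · have hc : Continuous fun a : ℝ => wrightTerm σ 1 (1 - a) y n := by
      have := continuous_inv_Gamma.comp (by fun_prop : Continuous fun a : ℝ => 1 - a - σ * n)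
      exact continuous_const.mul this
    exact (hc.tendsto' 0 _ (by simp)).mono_left nhdsWithin_le_nhds
  · filter_upwards [Ioo_mem_nhdsGT (one_pos : (0 : ℝ) < 1)] with a ha n
    refine (abs_wrightTerm_one_le ha.1 hσ0 y n).trans ?_
    rw [← mul_add]
    refine mul_le_mul_of_nonneg_left ?_ (by positivity)
    have h1 : 0 < 1 + σ * n := by positivity
    have h2 : 0 < 2 + σ * n := by positivity
    refine (Real.convexOn_Gamma.le_max_of_mem_Icc (x := 1 + σ * n) (y := 2 + σ * n) h1 h2
      ⟨by linarith [ha.1], by linarith [ha.2]⟩).trans ?_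
    exact max_le_add_of_nonneg (Real.Gamma_pos_of_pos h1).le (Real.Gamma_pos_of_pos h2).le

/-- The Wright function `φ(-σ, β; -y)` decays faster than any power of `y`. The recurrence in `β`
carries this from `β ≤ 1` to all `β`; it degenerates at `β = 1`, which is reached as a limit. -/
theorem exists_pow_mul_abs_wrightSeries_one_le_of_one_le {σ : ℝ} (hσ0 : 0 < σ) (hσ1 : σ < 1)
    (β : ℝ) (K : ℕ) : ∃ C, ∀ y ≥ 1, y ^ K * |wrightSeries σ 1 β y| ≤ C := by
  have h0 : ∀ β ≤ 1, ∀ K : ℕ, ∃ C, ∀ y ≥ 1, y ^ K * |wrightSeries σ 1 β y| ≤ C := by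
    intro β hβ K
    rcases hβ.lt_or_eq with hβ | rfl
    · obtain ⟨C, hC⟩ := exists_pow_mul_abs_wrightSeries_one_le hσ0 hσ1 (1 - β) K
      refine ⟨C, fun y hy => ?_⟩
      simpa using hC (1 - β) (by linarith) le_rfl y hy
    · obtain ⟨C, hC⟩ := exists_pow_mul_abs_wrightSeries_one_le hσ0 hσ1 1 K
      refine ⟨C, fun y hy => ?_⟩
      refine le_of_tendsto ((tendsto_wrightSeries_one hσ0 hσ1 y).abs.const_mul (y ^ K)) ?_
      filter_upwards [Ioo_mem_nhdsGT (one_pos : (0 : ℝ) < 1)] with a ha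
      exact hC a ha.1 ha.2.le y hy
  have h1 : ∀ M : ℕ, ∀ β ≤ 1 + σ * M, ∀ K : ℕ,
      ∃ C, ∀ y ≥ 1, y ^ K * |wrightSeries σ 1 β y| ≤ C := by
    intro M
    induction M with
    | zero => intro β hβ; exact h0 β (by simpa using hβ)
    | succ M ih =>
      intro β hβ K
      rcases le_or_gt β 1 with h | h
      · exact h0 β h K
      push_cast at hβ
      obtain ⟨C₁, hC₁⟩ := ih (β - 1) (by linarith) K
      obtain ⟨C₂, hC₂⟩ := ih (β - σ) (by linarith) (K + 1)
      refine ⟨(C₁ + σ * C₂) / (β - 1), fun y hy => ?_⟩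
      have hy0 : 0 < y := by linarith
      have hβ1 : 0 < β - 1 := by linarith
      rw [le_div_iff₀ hβ1]
      calc y ^ K * |wrightSeries σ 1 β y| * (β - 1)
          = y ^ K * |(β - 1) * wrightSeries σ 1 β y| := by
            rw [abs_mul, abs_of_pos hβ1]; ring
        _ ≤ y ^ K * (|wrightSeries σ 1 (β - 1) y| + |σ * (y * wrightSeries σ 1 (β - σ) y)|) := by
            rw [wrightSeries_one_recurrence hσ0 hσ1]
            exact mul_le_mul_of_nonneg_left (abs_sub _ _) (by positivity)
        _ = y ^ K * |wrightSeries σ 1 (β - 1) y| +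
            σ * (y ^ (K + 1) * |wrightSeries σ 1 (β - σ) y|) := by
            rw [abs_mul, abs_mul, abs_of_pos hσ0, abs_of_pos hy0]; ring
        _ ≤ C₁ + σ * C₂ :=
            add_le_add (hC₁ y hy) (mul_le_mul_of_nonneg_left (hC₂ y hy) hσ0.le)
  obtain ⟨M, hM⟩ := exists_nat_gt ((β - 1) / σ)
  rw [div_lt_iff₀ hσ0] at hM
  exact h1 M β (by linarith) K

theorem exists_abs_wrightSeries_one_le {σ : ℝ} (hσ0 : 0 < σ) (hσ1 : σ < 1) (β : ℝ) :
    ∃ C, ∀ y ≥ 0, |wrightSeries σ 1 β y| ≤ C := by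
  obtain ⟨C, hC⟩ := exists_pow_mul_abs_wrightSeries_one_le_of_one_le hσ0 hσ1 β 0
  refine ⟨max C (∑' n, |wrightTerm σ 1 β 1 n|), fun y hy => ?_⟩
  rcases le_total 1 y with h | h
  · exact le_max_of_le_left (by simpa using hC y h)
  · refine le_max_of_le_right ?_
    rw [wrightSeries, ← Real.norm_eq_abs]
    refine tsum_of_norm_bounded (summable_wrightTerm_one hσ0 hσ1 β 1).abs.hasSum fun n => ?_
    rw [Real.norm_eq_abs, wrightTerm, wrightTerm, abs_mul, abs_mul, abs_mul, abs_mul, abs_pow,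
      abs_pow, abs_neg, abs_neg, abs_one, one_pow, abs_of_nonneg hy]
    gcongr
    exact pow_le_one₀ hy h

/-! ### Bounds for half-integral `γ` -/

theorem integral_pow_mul_one_sub_rpow_half (n : ℕ) :
    ∫ u : ℝ in Set.Ioc 0 1, u ^ n * (1 - u) ^ (1 / 2 : ℝ) =
      n.factorial * Real.Gamma (3 / 2) * (Real.Gamma (n + 5 / 2))⁻¹ := by
  have h := Complex.betaIntegral_eq_Gamma_mul_div ((n + 1 : ℝ) : ℂ) ((3 / 2 : ℝ) : ℂ)
    (by rw [Complex.ofReal_re]; positivity) (by rw [Complex.ofReal_re]; positivity)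
  rw [← Complex.ofReal_add, Complex.Gamma_ofReal, Complex.Gamma_ofReal, Complex.Gamma_ofReal,
    Real.Gamma_nat_eq_factorial, Complex.betaIntegral,
    intervalIntegral.integral_of_le zero_le_one] at h
  rw [show (n : ℝ) + 5 / 2 = n + 1 + 3 / 2 by ring, ← Complex.ofReal_inj,
    ← integral_complex_ofReal, ← div_eq_mul_inv]
  push_cast at h ⊢
  rw [← h]
  refine MeasureTheory.setIntegral_congr_fun measurableSet_Ioc fun u hu => ?_
  have h1 : (1 - (u : ℂ)) ^ ((3 / 2 : ℂ) - 1) = (((1 - u) ^ (1 / 2 : ℝ) : ℝ) : ℂ) := by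
    rw [Complex.ofReal_cpow (by linarith [hu.2])]
    push_cast
    norm_num
  simp only [h1, add_sub_cancel_right, Complex.cpow_natCast]

/-- Euler's integral lifts bounds for the Wright function to `γ = 5/2`. -/
theorem exists_abs_wrightSeries_five_halves_le {σ : ℝ} (hσ0 : 0 < σ) (hσ1 : σ < 1) (β : ℝ) :
    ∃ C, ∀ x ≥ 0, |wrightSeries σ (5 / 2) β x| ≤ C := by
  obtain ⟨C, hC⟩ := exists_abs_wrightSeries_one_le hσ0 hσ1 β
  have hG : 0 < Real.Gamma (3 / 2) := Real.Gamma_pos_of_pos (by norm_num)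
  refine ⟨C / Real.Gamma (3 / 2), fun x hx => ?_⟩
  let F : ℕ → ℝ → ℝ := fun n u => wrightTerm σ 1 β x n * (u ^ n * (1 - u) ^ (1 / 2 : ℝ))
  have hterm : ∀ n, wrightTerm σ 1 β x n * (n.factorial * Real.Gamma (3 / 2) *
      (Real.Gamma (n + 5 / 2))⁻¹) = Real.Gamma (3 / 2) * wrightTerm σ (5 / 2) β x n := by
    intro n
    have : (n.factorial : ℝ) ≠ 0 := by exact_mod_cast n.factorial_ne_zero
    rw [wrightTerm, wrightTerm, Real.Gamma_nat_eq_factorial]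
    field_simp
  have hcont : ∀ n, Continuous (F n) := fun n => by
    have : Continuous fun u : ℝ => (1 - u) ^ (1 / 2 : ℝ) :=
      (continuous_const.sub continuous_id).rpow_const fun _ => Or.inr (by norm_num)
    exact continuous_const.mul ((continuous_pow n).mul this)
  have hint : ∀ n, MeasureTheory.IntegrableOn (F n) (Set.Ioc 0 1) := fun n =>
    (hcont n).integrableOn_Ioc
  have hval : ∀ n, ∫ u in Set.Ioc 0 1, F n u = Real.Gamma (3 / 2) * wrightTerm σ (5 / 2) β x n :=
    fun n => by
      simp only [F]
      rw [MeasureTheory.integral_const_mul, integral_pow_mul_one_sub_rpow_half, hterm]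
  have hnorm : ∀ n, ∫ u in Set.Ioc 0 1, ‖F n u‖ =
      |Real.Gamma (3 / 2) * wrightTerm σ (5 / 2) β x n| := by
    intro n
    rw [← hterm, abs_mul, abs_of_pos (by positivity : 0 < (n.factorial : ℝ) * Real.Gamma (3 / 2) *
      (Real.Gamma (n + 5 / 2))⁻¹), ← integral_pow_mul_one_sub_rpow_half,
      ← MeasureTheory.integral_const_mul]
    refine MeasureTheory.setIntegral_congr_fun measurableSet_Ioc fun u hu => ?_
    have : 0 ≤ (1 - u) ^ (1 / 2 : ℝ) := Real.rpow_nonneg (by linarith [hu.2]) _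
    simp only [F]
    rw [norm_mul, Real.norm_eq_abs, Real.norm_of_nonneg (mul_nonneg (pow_nonneg hu.1.le _) this)]
  have hs : Summable (wrightTerm σ (5 / 2) β x) := by
    simpa using summable_wrightTerm_half hσ0 hσ1 0 β x
  have h := MeasureTheory.hasSum_integral_of_summable_integral_norm hint
    (by simp_rw [hnorm]; exact (hs.mul_left _).abs)
  simp_rw [hval] at h
  have h2 := h.unique (hs.hasSum.mul_left (Real.Gamma (3 / 2)))
  have hF : ∀ u ∈ Set.Ioc (0 : ℝ) 1, ‖∑' n, F n u‖ ≤ C := by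
    intro u hu
    have h3 : ∑' n, F n u = wrightSeries σ 1 β (x * u) * (1 - u) ^ (1 / 2 : ℝ) := by
      rw [wrightSeries, ← tsum_mul_right]
      refine tsum_congr fun n => ?_
      simp only [F, wrightTerm]
      rw [← neg_mul, mul_pow]
      ring
    have h4 : 0 ≤ 1 - u := by linarith [hu.2]
    rw [h3, norm_mul, Real.norm_eq_abs, Real.norm_of_nonneg (Real.rpow_nonneg h4 _)]
    refine (mul_le_of_le_one_right (abs_nonneg _) ?_).trans (hC _ (mul_nonneg hx hu.1.le))
    exact Real.rpow_le_one h4 (by linarith [hu.1]) (by norm_num)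
  have h5 := MeasureTheory.norm_setIntegral_le_of_norm_le_const
    (μ := MeasureTheory.volume) (s := Set.Ioc (0 : ℝ) 1) (by simp) hF
  rw [h2, norm_mul, Real.norm_of_nonneg hG.le, Real.norm_eq_abs] at h5
  rw [le_div_iff₀ hG, mul_comm]
  simpa [wrightSeries] using h5

theorem exists_abs_wrightSeries_half_le {σ : ℝ} (hσ0 : 0 < σ) (hσ1 : σ < 1) (m : ℕ) (β : ℝ) :
    ∃ C, ∀ x ≥ 0, |wrightSeries σ (5 / 2 - m) β x| ≤ C := by
  induction m generalizing β with
  | zero => simpa using exists_abs_wrightSeries_five_halves_le hσ0 hσ1 β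
  | succ m ih =>
    obtain ⟨C₁, hC₁⟩ := ih β
    obtain ⟨C₂, hC₂⟩ := ih (β - 1)
    have hγ : (5 / 2 - (m + 1 : ℕ) : ℝ) + 1 = 5 / 2 - m := by push_cast; ring
    refine ⟨|(5 / 2 - (m + 1 : ℕ) : ℝ)| * C₁ + (|β - 1| * C₁ + C₂) / σ, fun x hx => ?_⟩
    rw [wrightSeries_contiguous hσ0 (by rw [hγ]; exact summable_wrightTerm_half hσ0 hσ1 m), hγ]
    refine (abs_add_le _ _).trans ?_
    rw [abs_mul, abs_div, abs_of_pos hσ0]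
    gcongr
    · exact hC₁ x hx
    · refine (abs_sub _ _).trans ?_
      rw [abs_mul]
      gcongr
      · exact hC₁ x hx
      · exact hC₂ x hx

/-- The shift relation improves boundedness for `γ - 1` to a bound `O(1/x)` for `γ`. -/
theorem exists_mul_abs_wrightSeries_half_le {σ : ℝ} (hσ0 : 0 < σ) (hσ1 : σ < 1) (m : ℕ) (β : ℝ) :
    ∃ C, ∀ x ≥ 0, x * |wrightSeries σ (5 / 2 - m) β x| ≤ C := by
  obtain ⟨C, hC⟩ := exists_abs_wrightSeries_half_le hσ0 hσ1 (m + 1) (β + σ)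
  refine ⟨|(Real.Gamma (5 / 2 - (m + 1 : ℕ)))⁻¹ * (Real.Gamma (β + σ))⁻¹| + C, fun x hx => ?_⟩
  have h := wrightSeries_shift (summable_wrightTerm_half hσ0 hσ1 (m + 1) (β + σ) x)
  rw [show (5 / 2 - (m + 1 : ℕ) : ℝ) + 1 = 5 / 2 - m by push_cast; ring, add_sub_cancel_right] at h
  calc x * |wrightSeries σ (5 / 2 - m) β x| = |x * wrightSeries σ (5 / 2 - m) β x| := by
        rw [abs_mul, abs_of_nonneg hx]
    _ = |(Real.Gamma (5 / 2 - (m + 1 : ℕ)))⁻¹ * (Real.Gamma (β + σ))⁻¹ -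
        wrightSeries σ (5 / 2 - (m + 1 : ℕ)) (β + σ) x| := by rw [h, sub_sub_cancel]
    _ ≤ _ := (abs_sub _ _).trans (add_le_add_right (hC x hx) _)

/-! ### The expansion -/

/-- Iterating the shift relation gives the expansion with an exact remainder. -/
theorem wrightSeries_sub_sum {σ γ : ℝ}
    (h : ∀ (m : ℕ) (β x : ℝ), Summable (wrightTerm σ (γ - m) β x))
    {x : ℝ} (hx : x ≠ 0) (β : ℝ) (N : ℕ) :
    wrightSeries σ γ β x - ∑ k ∈ Finset.range N, (-1) ^ k * (Real.Gamma (γ - 1 - k))⁻¹ *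
      (Real.Gamma (β + σ * (k + 1)))⁻¹ * (x ^ (k + 1))⁻¹ =
      (-1) ^ N * (x ^ N)⁻¹ * wrightSeries σ (γ - N) (β + σ * N) x := by
  induction N with
  | zero => simp
  | succ N ih =>
    have hs := wrightSeries_shift (h (N + 1) (β + σ * (N + 1 : ℕ)) x)
    rw [show γ - (N + 1 : ℕ) + 1 = γ - N by push_cast; ring,
      show β + σ * (N + 1 : ℕ) - σ = β + σ * N by push_cast; ring] at hs
    rw [Finset.sum_range_succ, ← sub_sub, ih, hs]
    push_cast
    rw [show γ - 1 - N = γ - (N + 1) by ring]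
    field_simp
    ring

/-- The reflection formula identifies the coefficients of the expansion at `γ = 3/2`. -/
theorem neg_one_pow_mul_inv_Gamma_half_sub (k : ℕ) :
    (-1) ^ k * (Real.Gamma (1 / 2 - k))⁻¹ = Real.Gamma (k + 1 / 2) / Real.pi := by
  have h := inv_Gamma_one_sub (a := (k : ℝ) + 1 / 2) (by positivity)
  rw [show Real.pi * ((k : ℝ) + 1 / 2) = k * Real.pi + Real.pi / 2 by ring,
    Real.sin_add_pi_div_two, Real.cos_nat_mul_pi,
    show 1 - ((k : ℝ) + 1 / 2) = 1 / 2 - k by ring] at h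
  rw [h, mul_div_assoc', mul_left_comm, ← mul_pow]
  simp

/-! ### The generalised Struve function -/

theorem generalisedStruveTerm_eq (ν σ : ℝ) (z : ℂ) (n : ℕ) :
    generalisedStruveTerm ν (-σ) z n = (z / 2) ^ (2 * n) *
      (((Real.Gamma (n + 3 / 2))⁻¹ * (Real.Gamma (ν + 3 / 2 - σ * n))⁻¹ : ℝ) : ℂ) := by
  rw [generalisedStruveTerm, show (n : ℂ) + 3 / 2 = ((n + 3 / 2 : ℝ) : ℂ) by push_cast; ring,
    show ((-σ : ℝ) : ℂ) * n + ν + 3 / 2 = ((ν + 3 / 2 - σ * n : ℝ) : ℂ) by push_cast; ring,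
    Complex.Gamma_ofReal, Complex.Gamma_ofReal, div_eq_mul_inv, mul_inv]
  push_cast
  rfl

theorem norm_generalisedStruveTerm (ν σ : ℝ) (z : ℂ) (n : ℕ) :
    ‖generalisedStruveTerm ν (-σ) z n‖ = |wrightTerm σ (3 / 2) (ν + 3 / 2) (‖z / 2‖ ^ 2) n| := by
  rw [generalisedStruveTerm_eq, wrightTerm, norm_mul, Complex.norm_real, mul_assoc, abs_mul,
    norm_pow, abs_pow, abs_neg, abs_of_nonneg (by positivity), ← pow_mul, Real.norm_eq_abs]

theorem generalisedStruveTerm_I_mul (ν σ r : ℝ) (n : ℕ) :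
    generalisedStruveTerm ν (-σ) (Complex.I * r) n =
      (wrightTerm σ (3 / 2) (ν + 3 / 2) ((r / 2) ^ 2) n : ℂ) := by
  rw [generalisedStruveTerm_eq, wrightTerm, mul_assoc, Complex.ofReal_mul, pow_mul]
  push_cast
  rw [mul_div_assoc, mul_pow, Complex.I_sq, neg_one_mul]

theorem cpow_mul_generalisedStruveL {ν σ r : ℝ} (hr : 0 < r) :
    (Complex.I * (r : ℂ) / 2) ^ (-(ν : ℂ) - 1) *
      generalisedStruveL ν (Complex.I * (r : ℂ)) (-σ) =
      (wrightSeries σ (3 / 2) (ν + 3 / 2) ((r / 2) ^ 2) : ℂ) := by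
  have h0 : Complex.I * (r : ℂ) / 2 ≠ 0 := by
    simp [hr.ne']
  rw [generalisedStruveL, ← mul_assoc, ← Complex.cpow_add _ _ h0,
    show -(ν : ℂ) - 1 + ((ν : ℂ) + 1) = 0 by ring, Complex.cpow_zero, one_mul, wrightSeries,
    Complex.ofReal_tsum]
  exact tsum_congr (generalisedStruveTerm_I_mul ν σ r)

theorem zpow_scale_eq {r : ℝ} (k : ℕ) :
    ((r : ℂ) / 2) ^ (-2 * (k : ℤ) - 2) = (((((r / 2) ^ 2) ^ (k + 1))⁻¹ : ℝ) : ℂ) := by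
  rw [show -2 * (k : ℤ) - 2 = -((2 * (k + 1) : ℕ) : ℤ) by push_cast; ring, zpow_neg, zpow_natCast,
    pow_mul]
  push_cast
  rfl

theorem isLittleO_zpow_scale (k : ℕ) :
    (fun r : ℝ => ((r : ℂ) / 2) ^ (-2 * ((k + 1 : ℕ) : ℤ) - 2)) =o[atTop]
      fun r : ℝ => ((r : ℂ) / 2) ^ (-2 * (k : ℤ) - 2) := by
  have h : Tendsto (fun r : ℝ => ((((r / 2) ^ 2)⁻¹ : ℝ) : ℂ)) atTop (nhds 0) := by
    refine (Complex.continuous_ofReal.tendsto' 0 0 Complex.ofReal_zero).comp ?_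
    exact ((tendsto_pow_atTop two_ne_zero).comp
      (tendsto_id.atTop_div_const two_pos)).inv_tendsto_atTop
  refine ((isBigO_refl _ _).mul_isLittleO ((isLittleO_one_iff ℂ).2 h)).congr (fun r => ?_)
    fun r => mul_one _
  rw [zpow_scale_eq, zpow_scale_eq, ← Complex.ofReal_mul, ← mul_inv, ← pow_succ]

theorem theorem5 (ν σ : ℝ) (hσ0 : 0 < σ) (hσ1 : σ < 1) :
    (∀ z : ℂ, Summable (generalisedStruveTerm ν (-σ) z)) ∧
    HasPoincareExpansion
      (fun r : ℝ => (Complex.I * (r : ℂ) / 2) ^ (-(ν : ℂ) - 1) *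
        generalisedStruveL ν (Complex.I * (r : ℂ)) (-σ))
      (fun k : ℕ => 1 / (Real.pi : ℂ) *
        (Complex.Gamma ((k : ℂ) + 1 / 2) /
          Complex.Gamma ((ν : ℂ) + 3 / 2 + (σ : ℂ) * ((k : ℂ) + 1))))
      (fun (k : ℕ) (r : ℝ) => ((r : ℂ) / 2) ^ (-2 * (k : ℤ) - 2)) := by
  have hγ : ∀ m : ℕ, (3 / 2 - m : ℝ) = 5 / 2 - (m + 1 : ℕ) := fun m => by push_cast; ring
  have hs : ∀ (m : ℕ) (β x : ℝ), Summable (wrightTerm σ (3 / 2 - m) β x) := fun m => by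
    rw [hγ]; exact summable_wrightTerm_half hσ0 hσ1 (m + 1)
  refine ⟨fun z => Summable.of_norm ?_, isLittleO_zpow_scale, fun N => ?_⟩
  · simp_rw [norm_generalisedStruveTerm]
    simpa using (hs 0 (ν + 3 / 2) (‖z / 2‖ ^ 2)).abs
  obtain ⟨C, hC⟩ := exists_mul_abs_wrightSeries_half_le hσ0 hσ1 (N + 1) (ν + 3 / 2 + σ * N)
  refine IsBigO.of_bound C ?_
  filter_upwards [eventually_gt_atTop 0] with r hr
  have hx : 0 < (r / 2) ^ 2 := by positivity
  set x := (r / 2) ^ 2 with hx_def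
  have hcoef : ∀ k : ℕ, 1 / (Real.pi : ℂ) * (Complex.Gamma ((k : ℂ) + 1 / 2) /
      Complex.Gamma ((ν : ℂ) + 3 / 2 + (σ : ℂ) * ((k : ℂ) + 1))) =
      (((-1) ^ k * (Real.Gamma (3 / 2 - 1 - k))⁻¹ *
        (Real.Gamma (ν + 3 / 2 + σ * (k + 1)))⁻¹ : ℝ) : ℂ) := by
    intro k
    rw [show (3 / 2 - 1 - k : ℝ) = 1 / 2 - k by ring, neg_one_pow_mul_inv_Gamma_half_sub,
      show (k : ℂ) + 1 / 2 = ((k + 1 / 2 : ℝ) : ℂ) by push_cast; ring,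
      show (ν : ℂ) + 3 / 2 + (σ : ℂ) * ((k : ℂ) + 1) = ((ν + 3 / 2 + σ * (k + 1) : ℝ) : ℂ) by
        push_cast; ring, Complex.Gamma_ofReal, Complex.Gamma_ofReal]
    push_cast
    ring
  simp_rw [hcoef, zpow_scale_eq]
  rw [cpow_mul_generalisedStruveL hr, ← hx_def]
  simp_rw [← Complex.ofReal_mul]
  rw [← Complex.ofReal_sum, ← Complex.ofReal_sub, wrightSeries_sub_sum hs hx.ne',
    Complex.norm_real, Complex.norm_real, Real.norm_eq_abs, Real.norm_of_nonneg (by positivity),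
    abs_mul, abs_mul, abs_pow, abs_neg, abs_one, one_pow, one_mul, abs_of_pos (by positivity), hγ]
  have := hC x hx.le
  calc (x ^ N)⁻¹ * |wrightSeries σ (5 / 2 - (N + 1 : ℕ)) (ν + 3 / 2 + σ * N) x|
      = (x * |wrightSeries σ (5 / 2 - (N + 1 : ℕ)) (ν + 3 / 2 + σ * N) x|) * (x ^ (N + 1))⁻¹ := by
        rw [pow_succ]; field_simp
    _ ≤ C * (x ^ (N + 1))⁻¹ := by gcongr
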